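/- Let $n\ge 2$ and let $b_1,\dots,b_n\in\mathbb R^n$ be linearly independent vectors, generating a full-rank lattice $L$. For a basis $B=[b_1,\dots,b_n]$ let $b_i^*=b_i-\sum_{j<i}\mu_{ij}b_j^*$, $\mu_{ij}=\langle b_i,b_j^*\rangle/\|b_j^*\|^2$, be its Gram–Schmidt orthogonalization, and put $B_i=\|b_i^*\|^2$, $\mathrm{Pot}(B)=\prod_{i=1}^n B_i^{\,n-i+1}$, $\mathrm{SS}(B)=\sum_{i=1}^n B_i$. For $i<k$ let $\sigma_{i,k}(B)=[b_1,\dots,b_{i-1},b_k,b_i,\dots,b_{k-1},b_{k+1},\dots,b_n]$. Let $M=\max_i\|b_i\|$ for the input basis, $\mathrm{vol}(L)=\sqrt{\det({}^tB B)}$, and $\alpha=M^n/\mathrm{vol}(L)$. Each of the algorithms LLL, DeepLLL, PotLLL and S²LLL with parameter $\delta$ starts with $k=2$ and the input basis and, while $k\le n$, executes the following block. First size-reduce $B$: for $i=1,\dots,n$ and all $j<i$ (with $j$ either always in increasing order or always in decreasing order) replace $b_i$ by $b_i-\lfloor\mu_{ij}\rceil b_j$, where $\mu_{ij}$ is the current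 coefficient and $\lfloor x\rceil=\lfloor x+\tfrac12\rfloor$ is the nearest integer. Then perform a test, which either increases $k$ by $1$, or selects an index $i<k$, replaces $B$ by $\sigma_{i,k}(B)$ and $k$ by $\max\{i,2\}$. The tests are: - LLL: increase $k$ if $B_k\ge(\delta-\mu_{k,k-1}^2)B_{k-1}$; otherwise select $i=k-1$. - DeepLLL: select the smallest $i<k$ with $\|b_k\|^2-\sum_{j<i}\mu_{kj}^2B_j<\delta B_i$; if there is none, increase $k$. - PotLLL: let $i$ be the largest index minimizing $\mathrm{Pot}(\sigma_{j,k}(B))$ over $1\le j\le k-1$; increase $k$ if $\delta\,\mathrm{Pot}(B)\le\mathrm{Pot}(\sigma_{i,k}(B))$; otherwise select $i$. - S²LLL: let $i$ be the largest index maximizing $S_{jk}=\mathrm{SS}(B)-\mathrm{SS}(\sigma_{j,k}(B))$ over $1\le j\le k-1$; increase $k$ if $S_{ik}\le(1-\delta)\mathrm{SS}(B)$; otherwise select $i$. The admissible parameters are $1/4<\delta\le1$ for LLL, DeepLLL and PotLLL, and $0<\delta\le1$ for S²LLL; in particular the optimal value $\delta=1$ is included. **Theorem.** For every $n\ge2$,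 every such input basis and every admissible $\delta$, each of the four algorithms halts, and the total number of executions of the while-block is at most $$(n-1)\Bigl(3\prod_{j=2}^{n-1}\bigl(2+\sqrt{j+3}\bigr)\Bigr)^n\alpha^{n-1} \;\le\;(n-1)\Bigl(\tfrac{2}{\sqrt5}+1\Bigr)^{n(n-2)}\alpha^{n-1}\Bigl(\tfrac{3\,(n+2)!}{8}\Bigr)^{n/2}.$$ Moreover, there is a sequence $\varepsilon_n\to0$, independent of the lattice and of its basis, such that for all $n\ge2$ the right-hand side equals $$\alpha^{n-1}\Bigl(\bigl(\tfrac{2}{\sqrt5}+1\bigr)e^{-1/2}\,n^{1/2+\varepsilon_n}\Bigr)^{n^2}.$$ -/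

import Mathlib

open Filter Topology

noncomputable section

namespace LatticeReduction

/-- Real `n`-space with the Euclidean norm. -/
abbrev Vec (n : ℕ) : Type := EuclideanSpace ℝ (Fin n)

/-- The Gram-Schmidt vector `b_i^*`. -/
def gso {n : ℕ} (b : Fin n → Vec n) (i : Fin n) : Vec n :=
  InnerProductSpace.gramSchmidt ℝ b i

/-- `B_i = ‖b_i^*‖ ^ 2`. -/
def normSqGSO {n : ℕ} (b : Fin n → Vec n) (i : Fin n) : ℝ :=
  ‖gso b i‖ ^ 2

/-- The Gram-Schmidt coefficient `μ_{i,j} = ⟨b_i, b_j^*⟩ / ‖b_j^*‖ ^ 2` (used for `j < i`). -/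
def mu {n : ℕ} (b : Fin n → Vec n) (i j : Fin n) : ℝ :=
  inner ℝ (b i) (gso b j) / ‖gso b j‖ ^ 2

/-- The volume `√(det (ᵗB B))` of the lattice with basis `b`. -/
def vol {n : ℕ} (b : Fin n → Vec n) : ℝ :=
  √(Matrix.of fun i j : Fin n => inner ℝ (b i) (b j)).det

/-- `M`, the largest norm of a vector of `b`. -/
def maxNorm {n : ℕ} (b : Fin n → Vec n) : ℝ :=
  ⨆ i, ‖b i‖

/-- `α = M ^ n / vol(L)`. -/
def alpha {n : ℕ} (b : Fin n → Vec n) : ℝ :=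
  maxNorm b ^ n / vol b

/-- `σ_{i,k}` (used for `i ≤ k`): the `k`-th entry is moved to position `i`, and the entries at
the positions `i, …, k - 1` are shifted by one to the right. -/
def moveTo {n : ℕ} {β : Type*} (i k : Fin n) (b : Fin n → β) : Fin n → β :=
  fun j =>
    if j = i then b k
    else if i < j ∧ j ≤ k then b ⟨j.1 - 1, lt_of_le_of_lt (Nat.sub_le _ _) j.2⟩
    else b j

/-- The potential `∏ i = 1, …, n, B_i ^ (n - i + 1)`; here `i` is counted from `0`. -/
def pot {n : ℕ} (b : Fin n → Vec n) : ℝ :=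
  ∏ i : Fin n, normSqGSO b i ^ (n - (i : ℕ))

/-- `SS(b) = ∑ i, B_i`. -/
def squaredSum {n : ℕ} (b : Fin n → Vec n) : ℝ :=
  ∑ i : Fin n, normSqGSO b i

/-- `S_{i,k} = SS(b) - SS(σ_{i,k}(b))`. -/
def squaredSumDrop {n : ℕ} (b : Fin n → Vec n) (i k : Fin n) : ℝ :=
  squaredSum b - squaredSum (moveTo i k b)

/-- The order in which size-reduction of one vector `b_i` runs through the indices `j < i`. -/
inductive ReductionOrder where
  | increasing
  | decreasing

/-- The indices `j < i`, in the given order. -/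
def ReductionOrder.indices {n : ℕ} (o : ReductionOrder) (i : Fin n) : List (Fin n) :=
  match o with
  | .increasing => (List.finRange n).filter (fun j => j < i)
  | .decreasing => ((List.finRange n).filter (fun j => j < i)).reverse

/-- The update `b_i ← b_i - ⌊μ_{i,j}⌉ b_j`. -/
def reduceEntry {n : ℕ} (b : Fin n → Vec n) (i j : Fin n) : Fin n → Vec n :=
  Function.update b i (b i - round (mu b i j) • b j)

/-- Size-reduction: for `i` running upwards through all indices, and for all `j < i` in the given
order, update `b_i ← b_i - ⌊μ_{i,j}⌉ b_j`, where `μ_{i,j}` is that of the current basis. -/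
def sizeReduce {n : ℕ} (o : ReductionOrder) (b : Fin n → Vec n) : Fin n → Vec n :=
  (List.finRange n).foldl (fun c i => (o.indices i).foldl (fun d j => reduceEntry d i j) c) b

/-- The largest index in `s` at which `f` attains its minimum over `s` (`none` if `s` is empty). -/
def lastArgmin {n : ℕ} (s : Finset (Fin n)) (f : Fin n → ℝ) : Option (Fin n) :=
  if h : (s.filter fun j => ∀ l ∈ s, f j ≤ f l).Nonempty then
    some ((s.filter fun j => ∀ l ∈ s, f j ≤ f l).max' h)
  else none

/-- The largest index in `s` at which `f` attains its maximum over `s` (`none` if `s` is empty). -/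
def lastArgmax {n : ℕ} (s : Finset (Fin n)) (f : Fin n → ℝ) : Option (Fin n) :=
  if h : (s.filter fun j => ∀ l ∈ s, f l ≤ f j).Nonempty then
    some ((s.filter fun j => ∀ l ∈ s, f l ≤ f j).max' h)
  else none

/-! Each algorithm tests the size-reduced basis `b` at the current index `k`. The result of the
test is `none` if `k` is to be increased, and `some i` if `σ_{i,k}` is to be applied. -/

/-- The test of LLL. -/
def testLLL {n : ℕ} (δ : ℝ) (b : Fin n → Vec n) (k : Fin n) : Option (Fin n) :=
  let p : Fin n := ⟨k.1 - 1, lt_of_le_of_lt (Nat.sub_le _ _) k.2⟩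
  if normSqGSO b k ≥ (δ - mu b k p ^ 2) * normSqGSO b p then none else some p

/-- The inner for-loop of DeepLLL over a list of indices, with current value `C`. -/
def deepLoop {n : ℕ} (δ : ℝ) (b : Fin n → Vec n) (k : Fin n) : List (Fin n) → ℝ → Option (Fin n)
  | [], _ => none
  | i :: is, C =>
      if C ≥ δ * ‖gso b i‖ ^ 2 then deepLoop δ b k is (C - mu b k i ^ 2 * ‖gso b i‖ ^ 2)
      else some i

/-- The test of DeepLLL. -/
def testDeepLLL {n : ℕ} (δ : ℝ) (b : Fin n → Vec n) (k : Fin n) : Option (Fin n) :=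
  deepLoop δ b k ((List.finRange n).filter (fun i => i < k)) (‖b k‖ ^ 2)

/-- The test of PotLLL. -/
def testPotLLL {n : ℕ} (δ : ℝ) (b : Fin n → Vec n) (k : Fin n) : Option (Fin n) :=
  match lastArgmin (Finset.Iio k) (fun j => pot (moveTo j k b)) with
  | none => none
  | some i => if δ * pot b ≤ pot (moveTo i k b) then none else some i

/-- The test of S²LLL. -/
def testS2LLL {n : ℕ} (δ : ℝ) (b : Fin n → Vec n) (k : Fin n) : Option (Fin n) :=
  match lastArgmax (Finset.Iio k) (fun j => squaredSumDrop b j k) with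
  | none => none
  | some i => if squaredSumDrop b i k ≤ (1 - δ) * squaredSum b then none else some i

/-- The four algorithms. -/
inductive Algorithm where
  | LLL
  | DeepLLL
  | PotLLL
  | S2LLL

/-- The test of each algorithm. -/
def Algorithm.test {n : ℕ} (A : Algorithm) (δ : ℝ) (b : Fin n → Vec n) (k : Fin n) :
    Option (Fin n) :=
  match A with
  | .LLL => testLLL δ b k
  | .DeepLLL => testDeepLLL δ b k
  | .PotLLL => testPotLLL δ b k
  | .S2LLL => testS2LLL δ b k

/-- The range of the parameter `δ` of each algorithm. -/
def Algorithm.Admissible (A : Algorithm) (δ : ℝ) : Prop :=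
  match A with
  | .LLL => 1 / 4 < δ ∧ δ ≤ 1
  | .DeepLLL => 1 / 4 < δ ∧ δ ≤ 1
  | .PotLLL => 1 / 4 < δ ∧ δ ≤ 1
  | .S2LLL => 0 < δ ∧ δ ≤ 1

/-- A state: the current basis and the current index. Indices are counted from `0`, so that `idx`
is `k - 1` for the usual index `k`, which is counted from `1`. -/
structure State (n : ℕ) where
  basis : Fin n → Vec n
  idx : ℕ

/-- The initial state: the input basis, and `k = 2`. -/
def initial {n : ℕ} (b : Fin n → Vec n) : State n := ⟨b, 1⟩

/-- The condition `k ≤ n` of the while-loop. -/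
def State.Running {n : ℕ} (s : State n) : Prop := s.idx < n

/-- One execution of the body of the while-loop: size-reduce, test, and either increase `k`, or
apply `σ_{i,k}` and set `k` to `max {i, 2}` (in counting from `1`). A state that has left the loop
is not changed. -/
def step {n : ℕ} (A : Algorithm) (o : ReductionOrder) (δ : ℝ) (s : State n) : State n :=
  if h : s.idx < n then
    match A.test δ (sizeReduce o s.basis) ⟨s.idx, h⟩ with
    | none => ⟨sizeReduce o s.basis, s.idx + 1⟩
    | some i => ⟨moveTo i ⟨s.idx, h⟩ (sizeReduce o s.basis), max (i : ℕ) 1⟩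
  else s

/-- The algorithm halts on the input `b`, and the body of its while-loop is executed exactly
`N` times. -/
def HaltsAfter {n : ℕ} (A : Algorithm) (o : ReductionOrder) (δ : ℝ) (b : Fin n → Vec n)
    (N : ℕ) : Prop :=
  (∀ m < N, ((step A o δ)^[m] (initial b)).Running) ∧
    ¬ ((step A o δ)^[N] (initial b)).Running

end LatticeReduction

end

/-! The argument counts states and needs no decrease by a fixed factor, so `δ = 1` costs nothing; of
`δ` only `δ ≤ 1` is used.

Every insertion `σ_{i,k}` chosen by any of the four tests strictly lowers `B_i` and leaves `B_j` for
`j < i` alone (`Algorithm.distSq_lt_of_test`). For LLL and DeepLLL this is the failed test itself.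
For PotLLL and S²LLL it comes from comparing `σ_{i,k}` with `σ_{i+1,k}`, which is strictly worse
because `i` is the largest optimal index. Size reduction keeps all Gram-Schmidt vectors, and
otherwise `k` grows. Since `i` is never the last position, the tuple of the first `n - 1` norms
followed by `-k` decreases lexicographically in each execution (`reachable_step`), so no pair
(norms, `k`) recurs.

It remains to bound the number of pairs. Insertions never raise the maximum of the `B_i`, so every
`B_i` stays at most `M ^ 2`. Nearest-plane reduction therefore gives a companion basis with the same
Gram-Schmidt vectors whose `j`-th vector (from `0`) is a lattice vector of norm at most `√(j + 4) /
2 * M` (`exists_sizeReduced`). Its first `n - 1` vectors determine the first `n - 1` norms. The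
lattice points in a ball of radius `R` are counted by boxes with sides `‖b_i^*‖` of the input basis:
each box holds at most one (`boxIndex_injective`), and there are at most `(2R + M) ^ n / vol` boxes
(`card_boxes_le`). With the radii above this is `(√(j + 4) + 1) ^ n * α` for each `j`. The product
over `j`, times the `n - 1` values of `k`, is the bound; the closed forms follow from elementary
estimates and Stirling's formula. -/

noncomputable section

namespace LatticeReduction

/-! ### Distances from subspaces -/

section Projection

variable {E : Type*} [NormedAddCommGroup E] [InnerProductSpace ℝ E] [FiniteDimensional ℝ E]

/-- The squared distance of `x` from the subspace `U`. -/
def distSq (U : Submodule ℝ E) (x : E) : ℝ := ‖Uᗮ.starProjection x‖ ^ 2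

lemma orthogonal_starProjection_eq {U : Submodule ℝ E} {x u : E} (hu : u ∈ Uᗮ)
    (hxu : x - u ∈ U) : Uᗮ.starProjection x = u :=
  Submodule.eq_starProjection_of_mem_orthogonal hu (by rwa [Submodule.orthogonal_orthogonal])

lemma sub_orthogonal_starProjection_mem (U : Submodule ℝ E) (x : E) :
    x - Uᗮ.starProjection x ∈ U := by
  rw [Submodule.starProjection_orthogonal_val, sub_sub_cancel]
  exact Submodule.starProjection_apply_mem _ _

lemma orthogonal_starProjection_congr {U : Submodule ℝ E} {x y : E} (h : x - y ∈ U) :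
    Uᗮ.starProjection x = Uᗮ.starProjection y := by
  refine orthogonal_starProjection_eq (Submodule.starProjection_apply_mem _ _) ?_
  rw [← sub_add_sub_cancel x y]
  exact U.add_mem h (sub_orthogonal_starProjection_mem U y)

lemma distSq_congr {U : Submodule ℝ E} {x y : E} (h : x - y ∈ U) : distSq U x = distSq U y := by
  rw [distSq, distSq, orthogonal_starProjection_congr h]

lemma distSq_bot (x : E) : distSq ⊥ x = ‖x‖ ^ 2 := by
  rw [distSq, orthogonal_starProjection_eq (u := x) (by simp) (by simp)]

lemma inner_orthogonal_starProjection_self (U : Submodule ℝ E) (x y : E) :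
    inner ℝ (Uᗮ.starProjection x) (Uᗮ.starProjection y) = inner ℝ (Uᗮ.starProjection x) y := by
  have := (Submodule.mem_orthogonal' _ _).1 (Submodule.starProjection_apply_mem Uᗮ x) _
    (sub_orthogonal_starProjection_mem U y)
  rw [inner_sub_right] at this
  linarith

/-- Both sides are the Gram determinant of the projections of `x` and `y` to `Uᗮ`. Multiplying by
`distSq U x` instead of dividing keeps the identity valid for `x ∈ U`, so independence need not be
tracked. -/
lemma distSq_sup_span_mul (U : Submodule ℝ E) (x y : E) :
    distSq (U ⊔ Submodule.span ℝ {x}) y * distSq U x =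
      distSq U y * distSq U x - inner ℝ (Uᗮ.starProjection x) y ^ 2 := by
  by_cases hx : Uᗮ.starProjection x = 0
  · simp [distSq, hx]
  have hx2 : ‖Uᗮ.starProjection x‖ ^ 2 ≠ 0 := by simpa using hx
  set x' := Uᗮ.starProjection x with hx'
  set y' := Uᗮ.starProjection y with hy'
  set t : ℝ := inner ℝ x' y / ‖x'‖ ^ 2 with ht
  have hxU : x - x' ∈ U := sub_orthogonal_starProjection_mem U x
  have hyU : y - y' ∈ U := sub_orthogonal_starProjection_mem U y
  have hx'U : x' ∈ Uᗮ := Submodule.starProjection_apply_mem _ _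
  have hy'U : y' ∈ Uᗮ := Submodule.starProjection_apply_mem _ _
  have hxy : inner ℝ x' y' = inner ℝ x' y := inner_orthogonal_starProjection_self U x y
  have hxx : inner ℝ x x' = ‖x'‖ ^ 2 := by
    rw [real_inner_comm, ← inner_orthogonal_starProjection_self U x x, real_inner_self_eq_norm_sq]
  have hxy'' : inner ℝ x y' = inner ℝ x' y := by
    rw [real_inner_comm, ← inner_orthogonal_starProjection_self U y x, real_inner_comm, hxy]
  have hproj : (U ⊔ Submodule.span ℝ {x})ᗮ.starProjection y = y' - t • x' := by
    refine orthogonal_starProjection_eq ?_ ?_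
    · rw [← Submodule.inf_orthogonal]
      refine ⟨Uᗮ.sub_mem hy'U (Uᗮ.smul_mem _ hx'U), ?_⟩
      rw [SetLike.mem_coe, Submodule.mem_orthogonal_singleton_iff_inner_right, inner_sub_right,
        inner_smul_right, hxx, hxy'', ht]
      field_simp
      simp
    · have h1 : x' ∈ U ⊔ Submodule.span ℝ {x} := by
        have := Submodule.sub_mem _
          ((le_sup_right : _ ≤ U ⊔ Submodule.span ℝ {x}) (Submodule.mem_span_singleton_self x))
          ((le_sup_left : U ≤ U ⊔ Submodule.span ℝ {x}) hxU)
        simpa using this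
      have := Submodule.add_mem _ ((le_sup_left : U ≤ U ⊔ Submodule.span ℝ {x}) hyU)
        (Submodule.smul_mem _ t h1)
      convert this using 1
      abel
  rw [distSq, hproj, distSq, distSq, norm_sub_sq_real, inner_smul_right, real_inner_comm, hxy,
    norm_smul, mul_pow, Real.norm_eq_abs, sq_abs, ht]
  field_simp
  ring

lemma distSq_sup_span_mul_comm (U : Submodule ℝ E) (x y : E) :
    distSq (U ⊔ Submodule.span ℝ {x}) y * distSq U x =
      distSq (U ⊔ Submodule.span ℝ {y}) x * distSq U y := by
  rw [distSq_sup_span_mul, distSq_sup_span_mul, ← inner_orthogonal_starProjection_self U x y,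
    ← inner_orthogonal_starProjection_self U y x, real_inner_comm, mul_comm (distSq U y)]

lemma distSq_anti {U V : Submodule ℝ E} (h : U ≤ V) (x : E) : distSq V x ≤ distSq U x := by
  have : Vᗮ.starProjection x = Vᗮ.starProjection (Uᗮ.starProjection x) :=
    orthogonal_starProjection_congr (h (sub_orthogonal_starProjection_mem U x))
  rw [distSq, this, distSq]
  gcongr
  exact Submodule.norm_starProjection_apply_le _ _

end Projection

/-! ### Gram-Schmidt vectors as projections away from the preceding span -/

section GramSchmidt

variable {n : ℕ}

/-- The span of the vectors `b_j` with `j < m`. -/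
def headSpan (b : Fin n → Vec n) (m : ℕ) : Submodule ℝ (Vec n) :=
  Submodule.span ℝ (b '' {j | (j : ℕ) < m})

lemma headSpan_zero (b : Fin n → Vec n) : headSpan b 0 = ⊥ := by simp [headSpan]

lemma headSpan_succ (b : Fin n → Vec n) (i : Fin n) :
    headSpan b (i + 1) = headSpan b i ⊔ Submodule.span ℝ {b i} := by
  rw [headSpan, headSpan, ← Submodule.span_union]
  congr 1
  ext x
  simp only [Set.mem_image, Set.mem_ofPred_eq, Set.union_singleton, Set.mem_insert_iff]
  constructor
  · rintro ⟨j, hj, rfl⟩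
    rcases Nat.lt_succ_iff_lt_or_eq.1 hj with h | h
    · exact Or.inr ⟨j, h, rfl⟩
    · left; congr 1; exact Fin.ext h
  · rintro (rfl | ⟨j, hj, rfl⟩)
    · exact ⟨i, by omega, rfl⟩
    · exact ⟨j, by omega, rfl⟩

lemma headSpan_mono (b : Fin n → Vec n) {l m : ℕ} (h : l ≤ m) : headSpan b l ≤ headSpan b m :=
  Submodule.span_mono (Set.image_mono fun _ hj => lt_of_lt_of_le hj h)

lemma mem_headSpan (b : Fin n → Vec n) {j : Fin n} {m : ℕ} (h : (j : ℕ) < m) :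
    b j ∈ headSpan b m :=
  Submodule.subset_span ⟨j, h, rfl⟩

lemma gso_eq (b : Fin n → Vec n) (i : Fin n) :
    gso b i = (headSpan b i)ᗮ.starProjection (b i) := by
  have hset : {j : Fin n | (j : ℕ) < i} = Set.Iio i := by ext j; simp
  symm
  refine orthogonal_starProjection_eq ?_ ?_
  · rw [headSpan, Submodule.mem_orthogonal]
    intro u hu
    induction hu using Submodule.span_induction with
    | mem x hx =>
      obtain ⟨j, hj, rfl⟩ := hx
      rw [real_inner_comm]
      exact InnerProductSpace.gramSchmidt_inv_triangular ℝ b (by simpa using hj)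
    | zero => simp
    | add x y _ _ hx hy => rw [inner_add_left, hx, hy, add_zero]
    | smul a x _ hx => rw [inner_smul_left, hx, mul_zero]
  · rw [headSpan, hset, ← InnerProductSpace.span_gramSchmidt_Iio, gso]
    nth_rewrite 1 [InnerProductSpace.gramSchmidt_def' ℝ b i]
    rw [add_sub_cancel_left]
    refine Submodule.sum_mem _ fun j hj => ?_
    have hle : Submodule.span ℝ {InnerProductSpace.gramSchmidt ℝ b j} ≤
        Submodule.span ℝ (InnerProductSpace.gramSchmidt ℝ b '' Set.Iio i) :=
      Submodule.span_mono (Set.singleton_subset_iff.2 ⟨j, by simpa using hj, rfl⟩)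
    exact hle (Submodule.starProjection_apply_mem _ (b i))

lemma normSqGSO_eq (b : Fin n → Vec n) (i : Fin n) :
    normSqGSO b i = distSq (headSpan b i) (b i) := by
  rw [normSqGSO, gso_eq, distSq]

lemma normSqGSO_nonneg (b : Fin n → Vec n) (i : Fin n) : 0 ≤ normSqGSO b i := sq_nonneg _

lemma inner_gso_of_mem {b : Fin n → Vec n} {i : Fin n} {x : Vec n} (hx : x ∈ headSpan b i) :
    inner ℝ x (gso b i) = 0 := by
  rw [gso_eq]
  exact (Submodule.mem_orthogonal _ _).1 (Submodule.starProjection_apply_mem _ _) _ hx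

lemma inner_self_gso (b : Fin n → Vec n) (i : Fin n) :
    inner ℝ (b i) (gso b i) = ‖gso b i‖ ^ 2 := by
  rw [gso_eq, real_inner_comm, ← inner_orthogonal_starProjection_self, real_inner_self_eq_norm_sq]

/-- Pythagoras, one coordinate at a time: the loop invariant of DeepLLL and the source of the norm
bound for size-reduced vectors. If `gso b i = 0`, the span does not grow and the quotient is `0` by
convention. -/
lemma distSq_headSpan_succ (b : Fin n → Vec n) (i : Fin n) (x : Vec n) :
    distSq (headSpan b (i + 1)) x =
      distSq (headSpan b i) x - (inner ℝ x (gso b i) / ‖gso b i‖ ^ 2) ^ 2 * ‖gso b i‖ ^ 2 := by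
  have h := distSq_sup_span_mul (headSpan b i) (b i) x
  rw [← headSpan_succ, ← gso_eq, ← normSqGSO_eq, normSqGSO, real_inner_comm] at h
  by_cases h0 : gso b i = 0
  · have hmem : b i ∈ headSpan b i := by
      have := sub_orthogonal_starProjection_mem (headSpan b i) (b i)
      rwa [← gso_eq, h0, sub_zero] at this
    have : headSpan b (i + 1) = headSpan b i := by
      rw [headSpan_succ]
      exact sup_eq_left.2 (by simpa using hmem)
    rw [this, h0]
    simp
  · have : ‖gso b i‖ ^ 2 ≠ 0 := by simpa using h0
    field_simp
    linarith

lemma gso_congr {b c : Fin n → Vec n} {i : Fin n} (h : ∀ j ≤ i, b j = c j) :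
    gso b i = gso c i := by
  have : headSpan b i = headSpan c i := by
    rw [headSpan, headSpan]
    congr 1
    refine Set.image_congr fun j hj => h j ?_
    exact le_of_lt hj
  rw [gso_eq, gso_eq, this, h i le_rfl]

end GramSchmidt

/-! ### Effect of an insertion on the Gram-Schmidt norms -/

section MoveTo

variable {n : ℕ}

lemma moveTo_apply_of_lt {β : Type*} {i k j : Fin n} (b : Fin n → β) (h : j < i) :
    moveTo i k b j = b j := by
  simp [moveTo, h.ne, h.not_gt]

lemma moveTo_apply_self {β : Type*} (i k : Fin n) (b : Fin n → β) : moveTo i k b i = b k := by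
  simp [moveTo]

lemma moveTo_apply_of_mem {β : Type*} {i k j l : Fin n} (b : Fin n → β) (hi : i < j) (hk : j ≤ k)
    (hl : (l : ℕ) + 1 = j) : moveTo i k b j = b l := by
  rw [moveTo, if_neg hi.ne', if_pos ⟨hi, hk⟩]
  congr 1
  exact Fin.ext (by simp; omega)

lemma moveTo_apply_of_gt {β : Type*} {i k j : Fin n} (b : Fin n → β) (hik : i ≤ k) (h : k < j) :
    moveTo i k b j = b j := by
  rw [moveTo, if_neg (hik.trans_lt h).ne', if_neg (fun h' => h'.2.not_gt h)]

lemma moveTo_self {β : Type*} (k : Fin n) (b : Fin n → β) : moveTo k k b = b := by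
  ext j
  rcases lt_trichotomy j k with h | rfl | h
  · rw [moveTo_apply_of_lt b h]
  · rw [moveTo_apply_self]
  · rw [moveTo_apply_of_gt b le_rfl h]

lemma moveTo_mem_range {β : Type*} (i k j : Fin n) (b : Fin n → β) :
    moveTo i k b j ∈ Set.range b := by
  rw [moveTo]
  split_ifs <;> exact ⟨_, rfl⟩

lemma headSpan_moveTo_of_le (b : Fin n → Vec n) {i k : Fin n} {m : ℕ} (h : m ≤ i) :
    headSpan (moveTo i k b) m = headSpan b m := by
  rw [headSpan, headSpan]
  congr 1
  refine Set.image_congr fun j hj => moveTo_apply_of_lt b ?_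
  exact Fin.lt_def.2 (lt_of_lt_of_le hj h)

lemma headSpan_moveTo_succ (b : Fin n → Vec n) {i k : Fin n} {m : ℕ} (hi : i ≤ m) (hk : m ≤ k) :
    headSpan (moveTo i k b) (m + 1) = headSpan b m ⊔ Submodule.span ℝ {b k} := by
  induction m, hi using Nat.le_induction with
  | base => rw [headSpan_succ, headSpan_moveTo_of_le b le_rfl, moveTo_apply_self]
  | succ m hi ih =>
    have hmn : m + 1 < n := lt_of_le_of_lt hk k.2
    have := headSpan_succ (moveTo i k b) ⟨m + 1, hmn⟩
    simp only at this
    rw [this, ih (by omega), moveTo_apply_of_mem (l := ⟨m, by omega⟩) b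
      (Fin.lt_def.2 (by simp; omega)) (Fin.le_def.2 hk) rfl, sup_right_comm,
      ← headSpan_succ b ⟨m, by omega⟩]

lemma headSpan_moveTo_of_gt (b : Fin n → Vec n) {i k : Fin n} (hik : i ≤ k) {m : ℕ} (h : k < m)
    (hm : m ≤ n) : headSpan (moveTo i k b) m = headSpan b m := by
  induction m, h using Nat.le_induction with
  | base => rw [headSpan_moveTo_succ b hik le_rfl, headSpan_succ]
  | succ m hk ih =>
    have h1 := headSpan_succ (moveTo i k b) ⟨m, hm⟩
    have h2 := headSpan_succ b ⟨m, hm⟩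
    simp only at h1 h2
    rw [h1, h2, ih (by omega), moveTo_apply_of_gt (j := ⟨m, hm⟩) b hik (Fin.lt_def.2 hk)]

lemma normSqGSO_moveTo_of_lt (b : Fin n → Vec n) {i k j : Fin n} (h : j < i) :
    normSqGSO (moveTo i k b) j = normSqGSO b j := by
  rw [normSqGSO_eq, normSqGSO_eq, headSpan_moveTo_of_le b h.le, moveTo_apply_of_lt b h]

lemma normSqGSO_moveTo_self (b : Fin n → Vec n) (i k : Fin n) :
    normSqGSO (moveTo i k b) i = distSq (headSpan b i) (b k) := by
  rw [normSqGSO_eq, headSpan_moveTo_of_le b le_rfl, moveTo_apply_self]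

lemma normSqGSO_moveTo_of_mem (b : Fin n → Vec n) {i k j l : Fin n} (hi : i < j) (hk : j ≤ k)
    (hl : (l : ℕ) + 1 = j) : normSqGSO (moveTo i k b) j =
      distSq (headSpan b l ⊔ Submodule.span ℝ {b k}) (b l) := by
  rw [normSqGSO_eq, moveTo_apply_of_mem b hi hk hl, ← hl, headSpan_moveTo_succ]
  · have := Fin.lt_def.1 hi; omega
  · have := Fin.le_def.1 hk; omega

lemma normSqGSO_moveTo_of_gt (b : Fin n → Vec n) {i k j : Fin n} (hik : i ≤ k) (h : k < j) :
    normSqGSO (moveTo i k b) j = normSqGSO b j := by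
  rw [normSqGSO_eq, normSqGSO_eq, headSpan_moveTo_of_gt b hik h j.2.le, moveTo_apply_of_gt b hik h]

/-- A vector shifted to the right is projected away from a larger span than before, so its norm
cannot grow; only position `i` needs a hypothesis. -/
lemma normSqGSO_moveTo_le {b : Fin n → Vec n} {i k : Fin n} (hik : i ≤ k) {C : ℝ}
    (hC : ∀ j, normSqGSO b j ≤ C) (hlt : distSq (headSpan b i) (b k) ≤ C) (j : Fin n) :
    normSqGSO (moveTo i k b) j ≤ C := by
  rcases lt_trichotomy j i with h | rfl | h
  · rw [normSqGSO_moveTo_of_lt b h]; exact hC j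
  · rwa [normSqGSO_moveTo_self]
  · rcases le_or_gt j k with hk | hk
    · have hj := Fin.lt_def.1 h
      have hjn := j.2
      rw [normSqGSO_moveTo_of_mem (l := ⟨j - 1, by omega⟩) b h hk (by simp; omega)]
      refine (distSq_anti le_sup_left _).trans ?_
      rw [← normSqGSO_eq]
      exact hC _
    · rw [normSqGSO_moveTo_of_gt b hik hk]; exact hC j

/-- `σ_{i,k}(b)` and `σ_{i+1,k}(b)` differ by a swap of the entries `i` and `i + 1`; the product of
the two squared Gram-Schmidt norms concerned is the same. -/
lemma normSqGSO_moveTo_mul (b : Fin n → Vec n) {i j k : Fin n} (hij : (i : ℕ) + 1 = j)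
    (hjk : j ≤ k) :
    normSqGSO (moveTo i k b) j * normSqGSO (moveTo i k b) i =
      normSqGSO (moveTo j k b) j * normSqGSO (moveTo j k b) i := by
  have h : i < j := Fin.lt_def.2 (by omega)
  rw [normSqGSO_moveTo_of_mem b h hjk hij, normSqGSO_moveTo_self, normSqGSO_moveTo_self,
    normSqGSO_moveTo_of_lt b h, normSqGSO_eq, ← hij, headSpan_succ, distSq_sup_span_mul_comm]

lemma normSqGSO_moveTo_eq_succ (b : Fin n → Vec n) {i j k l : Fin n} (hij : (i : ℕ) + 1 = j)
    (hjk : j ≤ k) (hi : l ≠ i) (hj : l ≠ j) :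
    normSqGSO (moveTo i k b) l = normSqGSO (moveTo j k b) l := by
  have h : i < j := Fin.lt_def.2 (by omega)
  rcases lt_or_gt_of_ne hi with h1 | h1
  · rw [normSqGSO_moveTo_of_lt b h1, normSqGSO_moveTo_of_lt b (h1.trans h)]
  have h2 : j < l := by
    have := Fin.lt_def.1 h1
    have := Fin.val_ne_of_ne hj
    exact Fin.lt_def.2 (by omega)
  rcases le_or_gt l k with hk | hk
  · have := Fin.lt_def.1 h1
    have hl : (⟨l - 1, by omega⟩ : Fin n).1 + 1 = l := by simp; omega
    rw [normSqGSO_moveTo_of_mem b h1 hk hl, normSqGSO_moveTo_of_mem b h2 hk hl]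
  · rw [normSqGSO_moveTo_of_gt b (h.le.trans hjk) hk, normSqGSO_moveTo_of_gt b hjk hk]

/-- The exponent of `B_i` in the potential exceeds that of `B_{i+1}` by one, and `B_i * B_{i+1}` is
the same for both bases. Hence each potential is `B_i` times a common nonnegative factor. -/
lemma distSq_lt_of_pot_lt {b : Fin n → Vec n} {i j k : Fin n} (hij : (i : ℕ) + 1 = j)
    (hjk : j ≤ k) (h : pot (moveTo i k b) < pot (moveTo j k b)) :
    distSq (headSpan b i) (b k) < normSqGSO b i := by
  have hlt : i < j := Fin.lt_def.2 (by omega)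
  have hmul := normSqGSO_moveTo_mul b hij hjk
  rw [← normSqGSO_moveTo_self, ← normSqGSO_moveTo_of_lt (k := k) b hlt]
  by_contra! hge
  refine h.not_ge ?_
  obtain ⟨r, hr⟩ : ∃ r : ℕ, n - (i : ℕ) = r + 1 ∧ n - (j : ℕ) = r :=
    ⟨n - (j : ℕ), by have := j.2; omega, rfl⟩
  have key : ∀ c : Fin n → Vec n, pot c =
      normSqGSO c i * (normSqGSO c j * normSqGSO c i) ^ r *
        ∏ l ∈ (Finset.univ.erase i).erase j, normSqGSO c l ^ (n - (l : ℕ)) := by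
    intro c
    rw [pot, ← Finset.mul_prod_erase _ _ (Finset.mem_univ i), ← Finset.mul_prod_erase _ _
      (Finset.mem_erase.2 ⟨hlt.ne', Finset.mem_univ j⟩), hr.1, hr.2, mul_pow, pow_succ]
    ac_rfl
  have hprod : ∏ l ∈ (Finset.univ.erase i).erase j, normSqGSO (moveTo i k b) l ^ (n - (l : ℕ)) =
      ∏ l ∈ (Finset.univ.erase i).erase j, normSqGSO (moveTo j k b) l ^ (n - (l : ℕ)) := by
    refine Finset.prod_congr rfl fun l hl => ?_
    simp only [Finset.mem_erase] at hl
    rw [normSqGSO_moveTo_eq_succ b hij hjk hl.2.1 hl.1]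
  rw [key, key, hmul, hprod]
  exact mul_le_mul_of_nonneg_right (mul_le_mul_of_nonneg_right hge
    (pow_nonneg (mul_nonneg (normSqGSO_nonneg _ _) (normSqGSO_nonneg _ _)) _))
    (Finset.prod_nonneg fun l _ => pow_nonneg (normSqGSO_nonneg _ _) _)

/-- Let `x, y` be the norms at `i, j` for `σ_{i,k}` and `a, d` those for `σ_{j,k}`. Then `x * y = a
* d` and `d ≤ x`. If `a ≤ x`, then `(x - a) * (x - d) ≥ 0` reads `x * (x + y) ≥ x * (a + d)`,
against the smaller sum; `x = 0` forces `a = d = 0` and is treated apart. -/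
lemma distSq_lt_of_squaredSum_lt {b : Fin n → Vec n} {i j k : Fin n} (hij : (i : ℕ) + 1 = j)
    (hjk : j ≤ k) (h : squaredSum (moveTo i k b) < squaredSum (moveTo j k b)) :
    distSq (headSpan b i) (b k) < normSqGSO b i := by
  have hlt : i < j := Fin.lt_def.2 (by omega)
  have hmul := normSqGSO_moveTo_mul b hij hjk
  have hle : normSqGSO (moveTo j k b) j ≤ normSqGSO (moveTo i k b) i := by
    rw [normSqGSO_moveTo_self, normSqGSO_moveTo_self]
    exact distSq_anti (headSpan_mono b hlt.le) _
  rw [← normSqGSO_moveTo_self, ← normSqGSO_moveTo_of_lt (k := k) b hlt]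
  have key : ∀ c : Fin n → Vec n, squaredSum c = normSqGSO c i + (normSqGSO c j +
        ∑ l ∈ (Finset.univ.erase i).erase j, normSqGSO c l) := by
    intro c
    rw [squaredSum, ← Finset.add_sum_erase _ _ (Finset.mem_univ i), ← Finset.add_sum_erase _ _
      (Finset.mem_erase.2 ⟨hlt.ne', Finset.mem_univ j⟩)]
  have hsum : ∑ l ∈ (Finset.univ.erase i).erase j, normSqGSO (moveTo i k b) l =
      ∑ l ∈ (Finset.univ.erase i).erase j, normSqGSO (moveTo j k b) l := by
    refine Finset.sum_congr rfl fun l hl => ?_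
    simp only [Finset.mem_erase] at hl
    rw [normSqGSO_moveTo_eq_succ b hij hjk hl.2.1 hl.1]
  rw [key, key, hsum] at h
  have h1 := normSqGSO_nonneg (moveTo i k b) i
  have h2 := normSqGSO_nonneg (moveTo i k b) j
  have h3 := normSqGSO_nonneg (moveTo j k b) i
  have h4 := normSqGSO_nonneg (moveTo j k b) j
  by_contra! hge
  rcases h1.eq_or_lt with h0 | h0
  · linarith
  · have := mul_nonneg (sub_nonneg.2 hge) (sub_nonneg.2 hle)
    have h5 := mul_lt_mul_of_pos_right h h0
    nlinarith

end MoveTo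

/-! ### Every selected insertion lowers the Gram-Schmidt norm at its position -/

section Test

variable {n : ℕ}

lemma lastArgmin_eq_some {s : Finset (Fin n)} {f : Fin n → ℝ} {i : Fin n}
    (h : lastArgmin s f = some i) : i ∈ s ∧ ∀ l ∈ s, i < l → f i < f l := by
  rw [lastArgmin] at h
  split_ifs at h with hne
  rw [Option.some_inj] at h
  have hmem := Finset.max'_mem _ hne
  rw [h, Finset.mem_filter] at hmem
  refine ⟨hmem.1, fun l hl hil => ?_⟩
  by_contra! hle
  have := Finset.le_max' (s.filter fun j => ∀ l ∈ s, f j ≤ f l) l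
    (Finset.mem_filter.2 ⟨hl, fun m hm => hle.trans (hmem.2 m hm)⟩)
  rw [h] at this
  exact this.not_gt hil

lemma lastArgmax_eq_lastArgmin (s : Finset (Fin n)) (f : Fin n → ℝ) :
    lastArgmax s f = lastArgmin s fun j => -f j := by
  simp [lastArgmax, lastArgmin]

lemma exists_succ_of_lt {i k : Fin n} (h : i < k) : ∃ j : Fin n, (i : ℕ) + 1 = j ∧ j ≤ k :=
  ⟨⟨i + 1, by have := Fin.lt_def.1 h; omega⟩, rfl, Fin.le_def.2 (by have := Fin.lt_def.1 h; simpa)⟩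

lemma distSq_lt_of_testLLL {δ : ℝ} (hδ : δ ≤ 1) {b : Fin n → Vec n} {k i : Fin n} (hk : 1 ≤ (k : ℕ))
    (h : testLLL δ b k = some i) : i < k ∧ distSq (headSpan b i) (b k) < normSqGSO b i := by
  simp only [testLLL] at h
  split_ifs at h with hlt
  rw [Option.some_inj] at h
  rw [h] at hlt
  have hik : (i : ℕ) + 1 = k := by rw [← h]; simp; omega
  refine ⟨Fin.lt_def.2 (by omega), ?_⟩
  have h1 := distSq_headSpan_succ b i (b k)
  rw [hik, ← normSqGSO_eq] at h1
  have h2 := normSqGSO_nonneg b i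
  rw [mu] at hlt
  rw [normSqGSO] at hlt h1 h2 ⊢
  rw [normSqGSO] at hlt
  nlinarith

/-- The loop invariant: on reaching index `m`, the running value `C` is the squared distance of
`b_k` from the span of the earlier vectors. -/
lemma distSq_lt_of_deepLoop {δ : ℝ} (hδ : δ ≤ 1) {b : Fin n → Vec n} {k i : Fin n} {m : ℕ}
    (h : deepLoop δ b k (((List.finRange n).drop m).filter (fun i => i < k))
      (distSq (headSpan b m) (b k)) = some i) :
    i < k ∧ distSq (headSpan b i) (b k) < normSqGSO b i := by
  induction hd : n - m generalizing m with
  | zero =>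
    rw [List.drop_eq_nil_of_le (by simp; omega)] at h
    simp [deepLoop] at h
  | succ d ih =>
    have hm : m < n := by omega
    rw [List.drop_eq_getElem_cons (by simpa using hm)] at h
    simp only [List.getElem_finRange, Fin.cast_mk, List.filter_cons] at h
    split_ifs at h with hmk
    · rw [deepLoop] at h
      split_ifs at h with hC
      · refine ih (m := m + 1) ?_ (by omega)
        rw [distSq_headSpan_succ b ⟨m, hm⟩ (b k)]
        exact h
      · rw [Option.some_inj] at h
        subst h
        refine ⟨by simpa using hmk, ?_⟩
        rw [normSqGSO]
        have := sq_nonneg ‖gso b ⟨m, hm⟩‖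
        simp only
        nlinarith
    · rw [List.filter_eq_nil_iff.2] at h
      · simp [deepLoop] at h
      · intro a ha
        obtain ⟨l, hl, rfl⟩ := List.mem_iff_getElem.1 ha
        simp only [List.getElem_drop, List.getElem_finRange, decide_eq_true_eq, Fin.lt_def] at hmk ⊢
        simp at hmk ⊢
        omega

lemma distSq_lt_of_testPotLLL {δ : ℝ} (hδ : δ ≤ 1) {b : Fin n → Vec n} {k i : Fin n}
    (h : testPotLLL δ b k = some i) : i < k ∧ distSq (headSpan b i) (b k) < normSqGSO b i := by
  rw [testPotLLL] at h
  split at h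
  · simp at h
  rename_i i' hi'
  split_ifs at h with hlt
  rw [Option.some_inj] at h
  subst h
  obtain ⟨hik, hmin⟩ := lastArgmin_eq_some hi'
  rw [Finset.mem_Iio] at hik
  refine ⟨hik, ?_⟩
  obtain ⟨j, hij, hjk⟩ := exists_succ_of_lt hik
  refine distSq_lt_of_pot_lt hij hjk ?_
  -- The neighbour `i + 1` is either `k`, where the insertion is trivial and the failed test
  -- compares with `pot b`, or a candidate rejected because `i` is the last minimizer.
  rcases hjk.eq_or_lt with rfl | hjk
  · rw [moveTo_self]
    have : 0 ≤ pot b := Finset.prod_nonneg fun l _ => pow_nonneg (normSqGSO_nonneg _ _) _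
    nlinarith
  · exact hmin j (Finset.mem_Iio.2 hjk) (Fin.lt_def.2 (by omega))

lemma distSq_lt_of_testS2LLL {δ : ℝ} (hδ : δ ≤ 1) {b : Fin n → Vec n} {k i : Fin n}
    (h : testS2LLL δ b k = some i) : i < k ∧ distSq (headSpan b i) (b k) < normSqGSO b i := by
  rw [testS2LLL] at h
  split at h
  · simp at h
  rename_i i' hi'
  split_ifs at h with hlt
  rw [Option.some_inj] at h
  subst h
  rw [lastArgmax_eq_lastArgmin] at hi'
  obtain ⟨hik, hmin⟩ := lastArgmin_eq_some hi'
  rw [Finset.mem_Iio] at hik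
  refine ⟨hik, ?_⟩
  obtain ⟨j, hij, hjk⟩ := exists_succ_of_lt hik
  refine distSq_lt_of_squaredSum_lt hij hjk ?_
  rcases hjk.eq_or_lt with rfl | hjk
  · rw [moveTo_self]
    have : 0 ≤ squaredSum b := Finset.sum_nonneg fun l _ => normSqGSO_nonneg _ _
    rw [squaredSumDrop] at hlt
    nlinarith
  · have := hmin j (Finset.mem_Iio.2 hjk) (Fin.lt_def.2 (by omega))
    simp only [squaredSumDrop] at this
    linarith

lemma Algorithm.Admissible.le_one {A : Algorithm} {δ : ℝ} (h : A.Admissible δ) : δ ≤ 1 := by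
  cases A <;> exact h.2

/-- Whenever an algorithm inserts `b_k` at position `i`, the `i`-th Gram-Schmidt norm decreases. -/
lemma Algorithm.distSq_lt_of_test {A : Algorithm} {δ : ℝ} (hδ : A.Admissible δ)
    {b : Fin n → Vec n} {k i : Fin n} (hk : 1 ≤ (k : ℕ)) (h : A.test δ b k = some i) :
    i < k ∧ distSq (headSpan b i) (b k) < normSqGSO b i := by
  have hδ1 := hδ.le_one
  cases A
  · exact distSq_lt_of_testLLL hδ1 hk h
  · refine distSq_lt_of_deepLoop (m := 0) hδ1 ?_
    rw [headSpan_zero, distSq_bot]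
    exact h
  · exact distSq_lt_of_testPotLLL hδ1 h
  · exact distSq_lt_of_testS2LLL hδ1 h

end Test

/-! ### Size reduction and size-reduced companions -/

section SizeReduction

variable {n : ℕ}

/-- `c` has the same Gram-Schmidt vectors as `b`, and its entries lie in the lattice of `b`. -/
structure SameFlag (b c : Fin n → Vec n) : Prop where
  gso_eq : ∀ i, gso c i = gso b i
  mem_span : ∀ i, c i ∈ Submodule.span ℤ (Set.range b)

lemma SameFlag.refl (b : Fin n → Vec n) : SameFlag b b :=
  ⟨fun _ => rfl, fun i => Submodule.subset_span ⟨i, rfl⟩⟩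

lemma SameFlag.trans {b c d : Fin n → Vec n} (h : SameFlag b c) (h' : SameFlag c d) :
    SameFlag b d :=
  ⟨fun i => (h'.gso_eq i).trans (h.gso_eq i), fun i =>
    Submodule.span_le.2 (Set.range_subset_iff.2 h.mem_span) (h'.mem_span i)⟩

/-- A unitriangular change of vectors preserves all initial spans and the projections away from
them. -/
lemma gso_eq_of_sub_mem {b c : Fin n → Vec n} (h : ∀ l : Fin n, c l - b l ∈ headSpan b l) (i : Fin n) :
    gso c i = gso b i := by
  have hspan : ∀ m ≤ n, headSpan c m = headSpan b m := by
    intro m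
    induction m with
    | zero => intro _; rw [headSpan_zero, headSpan_zero]
    | succ m ih =>
      intro hm
      have h1 := headSpan_succ c ⟨m, hm⟩
      have h2 := headSpan_succ b ⟨m, hm⟩
      simp only at h1 h2
      rw [h1, h2, ih (by omega)]
      have hd := h ⟨m, hm⟩
      simp only at hd
      refine le_antisymm (sup_le le_sup_left ?_) (sup_le le_sup_left ?_) <;>
        rw [Submodule.span_singleton_le_iff_mem]
      · have := Submodule.add_mem_sup hd (Submodule.mem_span_singleton_self (R := ℝ) (b ⟨m, hm⟩))
        rwa [sub_add_cancel] at this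
      · have := Submodule.add_mem_sup ((headSpan b m).neg_mem hd)
          (Submodule.mem_span_singleton_self (R := ℝ) (c ⟨m, hm⟩))
        simpa using this
  rw [LatticeReduction.gso_eq, LatticeReduction.gso_eq, hspan _ i.2.le,
    orthogonal_starProjection_congr (h i)]

lemma sameFlag_reduceEntry (b : Fin n → Vec n) {i j : Fin n} (hij : j < i) :
    SameFlag b (reduceEntry b i j) := by
  refine ⟨gso_eq_of_sub_mem fun l => ?_, fun l => ?_⟩
  · rcases eq_or_ne l i with rfl | hl
    · rw [reduceEntry, Function.update_self, sub_sub_cancel_left, ← Int.cast_smul_eq_zsmul ℝ]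
      exact Submodule.neg_mem _ (Submodule.smul_mem _ _ (mem_headSpan b hij))
    · rw [reduceEntry, Function.update_of_ne hl, sub_self]
      exact Submodule.zero_mem _
  · rcases eq_or_ne l i with rfl | hl
    · rw [reduceEntry, Function.update_self]
      exact Submodule.sub_mem _ (Submodule.subset_span ⟨_, rfl⟩)
        (Submodule.smul_mem _ _ (Submodule.subset_span ⟨_, rfl⟩))
    · rw [reduceEntry, Function.update_of_ne hl]
      exact Submodule.subset_span ⟨_, rfl⟩

lemma lt_of_mem_indices {o : ReductionOrder} {i j : Fin n} (h : j ∈ o.indices i) : j < i := by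
  cases o <;> simpa [ReductionOrder.indices] using h

lemma sameFlag_sizeReduce (o : ReductionOrder) (b : Fin n → Vec n) :
    SameFlag b (sizeReduce o b) := by
  rw [sizeReduce]
  refine List.foldlRecOn (motive := SameFlag b) _ _ (SameFlag.refl b) fun c hc i _ => ?_
  refine List.foldlRecOn (motive := SameFlag b) _ _ hc fun d hd j hj => ?_
  exact hd.trans (sameFlag_reduceEntry d (lt_of_mem_indices hj))

/-- Nearest-plane reduction, running down from `j - 1`: subtracting a multiple of `b m` does not
disturb the coefficients at indices above `m`. The increasing order lacks this property, which is
why a companion replaces the output of `sizeReduce`. -/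
lemma exists_abs_inner_gso_le (b : Fin n → Vec n) (j : Fin n) (d : ℕ) (hd : d ≤ j) :
    ∃ w : Vec n, w ∈ Submodule.span ℤ (Set.range b) ∧ w - b j ∈ headSpan b j ∧
      ∀ i < j, (j : ℕ) ≤ i + d → |inner ℝ w (gso b i) / ‖gso b i‖ ^ 2| ≤ 1 / 2 := by
  induction d with
  | zero =>
    exact ⟨b j, Submodule.subset_span ⟨j, rfl⟩, by simp, fun i hi h =>
      absurd (Fin.lt_def.1 hi) (by omega)⟩
  | succ d ih =>
    obtain ⟨w, hw, hwj, hwi⟩ := ih (by omega)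
    have hjn := j.2
    let m : Fin n := ⟨j - (d + 1), by omega⟩
    have hm : (m : ℕ) + (d + 1) = j := by simp [m]; omega
    refine ⟨w - round (inner ℝ w (gso b m) / ‖gso b m‖ ^ 2) • b m, ?_, ?_, fun i hi h => ?_⟩
    · exact Submodule.sub_mem _ hw (Submodule.smul_mem _ _ (Submodule.subset_span ⟨_, rfl⟩))
    · rw [sub_right_comm, ← Int.cast_smul_eq_zsmul ℝ]
      exact Submodule.sub_mem _ hwj (Submodule.smul_mem _ _ (mem_headSpan b (by omega)))
    · rw [← Int.cast_smul_eq_zsmul ℝ, inner_sub_left, inner_smul_left]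
      rcases (show (m : ℕ) ≤ i by omega).eq_or_lt with hmi | hmi
      · obtain rfl : m = i := Fin.ext hmi
        rw [inner_self_gso]
        by_cases h0 : ‖gso b m‖ ^ 2 = 0
        · simp [h0]
        · rw [sub_div, mul_div_assoc, div_self h0, mul_one]
          exact abs_sub_round _
      · rw [inner_gso_of_mem (mem_headSpan b hmi), mul_zero, sub_zero]
        exact hwi i hi (by omega)

/-- Every basis has a size-reduced companion with the same Gram-Schmidt vectors. -/
lemma exists_sizeReduced (b : Fin n → Vec n) {C : ℝ} (hC : ∀ i, normSqGSO b i ≤ C) :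
    ∃ c : Fin n → Vec n, SameFlag b c ∧ ∀ j : Fin n, ‖c j‖ ^ 2 ≤ ((j : ℝ) + 4) / 4 * C := by
  choose c hc hcj hci using fun j : Fin n => exists_abs_inner_gso_le b j j le_rfl
  refine ⟨c, ⟨gso_eq_of_sub_mem hcj, hc⟩, fun j => ?_⟩
  have key : ∀ m ≤ (j : ℕ), ‖c j‖ ^ 2 ≤ distSq (headSpan b m) (c j) + (m : ℝ) / 4 * C := by
    intro m
    induction m with
    | zero => intro _; simp [headSpan_zero, distSq_bot]
    | succ m ih =>
      intro hm
      have hmn : m < n := by have := j.2; omega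
      have h1 := distSq_headSpan_succ b ⟨m, hmn⟩ (c j)
      have h2 := hci j ⟨m, hmn⟩ (Fin.lt_def.2 hm) (by simp)
      have h3 := hC ⟨m, hmn⟩
      have h4 := normSqGSO_nonneg b ⟨m, hmn⟩
      rw [normSqGSO] at h3 h4
      set t : ℝ := inner ℝ (c j) (gso b ⟨m, hmn⟩) / ‖gso b ⟨m, hmn⟩‖ ^ 2 with ht
      have h5 : t ^ 2 ≤ 1 / 4 := by
        have := sq_le_sq' (by linarith [(abs_le.1 h2).1]) (abs_le.1 h2).2
        linarith
      have h6 := ih (by omega)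
      have h7 : t ^ 2 * ‖gso b ⟨m, hmn⟩‖ ^ 2 ≤ 1 / 4 * C := by gcongr
      simp only at h1
      push_cast
      rw [h1]
      linarith
  have h1 := key j le_rfl
  rw [distSq_congr (hcj j), ← normSqGSO_eq] at h1
  linarith [hC j]

end SizeReduction

/-! ### Counting lattice vectors in a ball -/

section Counting

variable {n : ℕ}

lemma norm_gso_pos {b : Fin n → Vec n} (hb : LinearIndependent ℝ b) (i : Fin n) :
    0 < ‖gso b i‖ :=
  norm_pos_iff.2 (InnerProductSpace.gramSchmidt_ne_zero i hb)

lemma eq_zero_of_abs_inner_gso_lt {b : Fin n → Vec n} {x : Vec n}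
    (hx : x ∈ Submodule.span ℤ (Set.range b))
    (h : ∀ i, |inner ℝ x (gso b i)| < ‖gso b i‖ ^ 2) : x = 0 := by
  obtain ⟨z, rfl⟩ := (Submodule.mem_span_range_iff_exists_fun ℤ).1 hx
  suffices hz : z = 0 by simp [hz]
  by_contra hz
  -- At the last nonzero coefficient the inner product with `gso b i` is an integer multiple,
  -- nonzero, of `‖gso b i‖ ^ 2`.
  obtain ⟨i, hi, hmax⟩ : ∃ i, z i ≠ 0 ∧ ∀ j, i < j → z j = 0 := by
    have hne : (Finset.univ.filter fun i => z i ≠ 0).Nonempty := by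
      obtain ⟨i, hi⟩ := Function.ne_iff.1 hz
      exact ⟨i, by simpa using hi⟩
    refine ⟨_, (Finset.mem_filter.1 (Finset.max'_mem _ hne)).2, fun j hj => ?_⟩
    by_contra hj0
    exact (Finset.le_max' _ j (Finset.mem_filter.2 ⟨Finset.mem_univ _, hj0⟩)).not_gt hj
  have hi' := h i
  have hsum : inner ℝ (∑ l, z l • b l) (gso b i) = (z i : ℝ) * ‖gso b i‖ ^ 2 := by
    rw [sum_inner, Finset.sum_eq_single i]
    · rw [← Int.cast_smul_eq_zsmul ℝ, inner_smul_left, inner_self_gso]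
      rfl
    · intro l _ hl
      rcases lt_or_gt_of_ne hl with hli | hli
      · rw [← Int.cast_smul_eq_zsmul ℝ, inner_smul_left,
          inner_gso_of_mem (mem_headSpan b (Fin.lt_def.1 hli)), mul_zero]
      · rw [hmax l hli, zero_smul, inner_zero_left]
    · simp
  rw [hsum, abs_mul, abs_of_nonneg (sq_nonneg ‖gso b i‖)] at hi'
  have h1 : (1 : ℝ) ≤ |(z i : ℝ)| := by exact_mod_cast Int.one_le_abs hi
  nlinarith [sq_nonneg ‖gso b i‖]

/-- The box containing `x` in a tiling of space by boxes with sides `‖b_i^*‖` along the Gram-Schmidt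
vectors, in the ball of radius `R`. -/
def boxIndex (b : Fin n → Vec n) (R : ℝ) (x : Vec n) : Fin n → ℕ :=
  fun i => ⌊(inner ℝ x (gso b i) / ‖gso b i‖ + R) / ‖gso b i‖⌋₊

lemma abs_inner_gso_div_le {b : Fin n → Vec n} {R : ℝ} {x : Vec n}
    (hx : ‖x‖ ≤ R) (i : Fin n) : |inner ℝ x (gso b i) / ‖gso b i‖| ≤ R := by
  rw [abs_div, abs_norm]
  refine div_le_of_le_mul₀ (norm_nonneg _) ((norm_nonneg _).trans hx) ?_
  exact (abs_real_inner_le_norm _ _).trans (by gcongr)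

/-- The shift by `R` in `boxIndex` moves the coordinates from `[-R, R]` to `[0, 2R]`, so the
natural-number floor loses nothing. -/
lemma boxIndex_mem {b : Fin n → Vec n} {R : ℝ} {x : Vec n}
    (hx : ‖x‖ ≤ R) :
    boxIndex b R x ∈ Fintype.piFinset fun i => Finset.range (⌊2 * R / ‖gso b i‖⌋₊ + 1) := by
  rw [Fintype.mem_piFinset]
  intro i
  rw [Finset.mem_range, Nat.lt_succ_iff]
  refine Nat.floor_le_floor ?_
  have := (abs_le.1 (abs_inner_gso_div_le (b := b) hx i)).2
  gcongr
  linarith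

lemma boxIndex_injective {b : Fin n → Vec n} (hb : LinearIndependent ℝ b) {R : ℝ} {x y : Vec n}
    (hx : ‖x‖ ≤ R) (hy : ‖y‖ ≤ R) (hxL : x ∈ Submodule.span ℤ (Set.range b))
    (hyL : y ∈ Submodule.span ℤ (Set.range b)) (h : boxIndex b R x = boxIndex b R y) : x = y := by
  refine sub_eq_zero.1 (eq_zero_of_abs_inner_gso_lt (Submodule.sub_mem _ hxL hyL) fun i => ?_)
  have hpos := norm_gso_pos hb i
  have nonneg : ∀ w : Vec n, ‖w‖ ≤ R →
      0 ≤ (inner ℝ w (gso b i) / ‖gso b i‖ + R) / ‖gso b i‖ := fun w hw =>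
    div_nonneg (by linarith [(abs_le.1 (abs_inner_gso_div_le (b := b) hw i)).1]) hpos.le
  have hi := congrFun h i
  have h1 := Nat.floor_le (nonneg x hx)
  have h2 := Nat.lt_floor_add_one ((inner ℝ x (gso b i) / ‖gso b i‖ + R) / ‖gso b i‖)
  have h3 := Nat.floor_le (nonneg y hy)
  have h4 := Nat.lt_floor_add_one ((inner ℝ y (gso b i) / ‖gso b i‖ + R) / ‖gso b i‖)
  simp only [boxIndex] at hi
  rw [hi] at h1 h2
  have h5 : |(inner ℝ x (gso b i) / ‖gso b i‖ + R) / ‖gso b i‖ -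
      (inner ℝ y (gso b i) / ‖gso b i‖ + R) / ‖gso b i‖| < 1 := by
    rw [abs_lt]; constructor <;> linarith
  have h6 : (inner ℝ x (gso b i) / ‖gso b i‖ + R) / ‖gso b i‖ -
      (inner ℝ y (gso b i) / ‖gso b i‖ + R) / ‖gso b i‖ =
      inner ℝ (x - y) (gso b i) / ‖gso b i‖ ^ 2 := by
    rw [inner_sub_left]; field_simp; ring
  rwa [h6, abs_div, abs_of_nonneg (sq_nonneg ‖gso b i‖), div_lt_one (by positivity)] at h5

/-- In the Gram-Schmidt orthonormal basis the matrix of `b` is triangular with diagonal entries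
`‖gso b i‖` up to sign, and the Gram matrix is its transpose times itself. -/
lemma vol_eq (b : Fin n → Vec n) : vol b = ∏ i, ‖gso b i‖ := by
  have hcard : Module.finrank ℝ (Vec n) = Fintype.card (Fin n) := by simp
  set e := InnerProductSpace.gramSchmidtOrthonormalBasis hcard b
  have h1 : (Matrix.of fun i j : Fin n => inner ℝ (b i) (b j)) =
      (e.toBasis.toMatrix b).transpose * e.toBasis.toMatrix b := by
    ext i j
    simp only [Matrix.of_apply, Matrix.mul_apply, Matrix.transpose_apply,
      Module.Basis.toMatrix_apply, OrthonormalBasis.coe_toBasis_repr_apply,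
      OrthonormalBasis.repr_apply_apply]
    rw [← e.sum_inner_mul_inner]
    refine Finset.sum_congr rfl fun l _ => ?_
    rw [real_inner_comm]
  rw [vol, h1, Matrix.det_mul, Matrix.det_transpose, Real.sqrt_mul_self_eq_abs,
    ← Module.Basis.det_apply, InnerProductSpace.gramSchmidtOrthonormalBasis_det, Finset.abs_prod]
  refine Finset.prod_congr rfl fun i _ => ?_
  by_cases h0 : InnerProductSpace.gramSchmidtNormed ℝ b i = 0
  · rw [InnerProductSpace.inner_gramSchmidtOrthonormalBasis_eq_zero hcard h0, abs_zero]
    have h2 : InnerProductSpace.gramSchmidt ℝ b i = 0 := by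
      simpa [InnerProductSpace.gramSchmidtNormed] using h0
    rw [gso, h2, norm_zero]
  · rw [InnerProductSpace.gramSchmidtOrthonormalBasis_apply hcard h0,
      InnerProductSpace.gramSchmidtNormed, inner_smul_left]
    have := inner_self_gso b i
    rw [real_inner_comm] at this
    change |_ * inner ℝ (gso b i) (b i)| = _
    rw [this]
    by_cases h1 : ‖gso b i‖ = 0
    · simp [h1]
    · simp only [RCLike.ofReal_real_eq_id, id_eq, map_inv₀, conj_trivial]
      change |‖gso b i‖⁻¹ * _| = _
      rw [pow_two, inv_mul_cancel_left₀ h1, abs_norm]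

lemma card_boxes_le {b : Fin n → Vec n} (hb : LinearIndependent ℝ b) {R M : ℝ} (hR : 0 ≤ R)
    (hM : ∀ i, ‖gso b i‖ ≤ M) :
    ((Fintype.piFinset fun i => Finset.range (⌊2 * R / ‖gso b i‖⌋₊ + 1)).card : ℝ) ≤
      (2 * R + M) ^ n / vol b := by
  rw [Fintype.card_piFinset, vol_eq]
  simp only [Finset.card_range]
  push_cast
  calc ∏ i, ((⌊2 * R / ‖gso b i‖⌋₊ : ℝ) + 1) ≤ ∏ i, ((2 * R + M) / ‖gso b i‖) := by
        refine Finset.prod_le_prod (fun i _ => by positivity) fun i _ => ?_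
        have hpos := norm_gso_pos hb i
        have h1 := Nat.floor_le (show 0 ≤ 2 * R / ‖gso b i‖ by positivity)
        have h2 : 1 ≤ M / ‖gso b i‖ := (one_le_div hpos).2 (hM i)
        rw [add_div]
        linarith
    _ = _ := by simp [Finset.prod_div_distrib]

end Counting

/-! ### Strict progress, halting and the count of executions -/

section Halting

variable {n : ℕ}

/-- The properties common to all states that are reached from the basis `b`. -/
structure Reachable (b : Fin n → Vec n) (C : ℝ) (s : State n) : Prop where
  one_le_idx : 1 ≤ s.idx
  mem_span : ∀ i, s.basis i ∈ Submodule.span ℤ (Set.range b)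
  normSqGSO_le : ∀ i, normSqGSO s.basis i ≤ C

/-- A quantity that decreases in every execution of the body of the while-loop. -/
def progress (s : State n) : Lex (Lex (Fin (n - 1) → ℝ) × ℤ) :=
  toLex (toLex fun j => normSqGSO s.basis (Fin.castLE (n.sub_le 1) j), -(s.idx : ℤ))

lemma SameFlag.normSqGSO_eq {b c : Fin n → Vec n} (h : SameFlag b c) (i : Fin n) :
    normSqGSO c i = normSqGSO b i := by
  rw [normSqGSO, normSqGSO, h.gso_eq]

lemma reachable_step {A : Algorithm} {o : ReductionOrder} {δ : ℝ} (hδ : A.Admissible δ)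
    {b : Fin n → Vec n} {C : ℝ} {s : State n} (hs : Reachable b C s) (hrun : s.Running) :
    Reachable b C (step A o δ s) ∧ progress (step A o δ s) < progress s := by
  have hrun' : s.idx < n := hrun
  have hflag := sameFlag_sizeReduce o s.basis
  have hmem : ∀ i, sizeReduce o s.basis i ∈ Submodule.span ℤ (Set.range b) := fun i =>
    Submodule.span_le.2 (Set.range_subset_iff.2 hs.mem_span) (hflag.mem_span i)
  have hC : ∀ i, normSqGSO (sizeReduce o s.basis) i ≤ C := fun i => by
    rw [hflag.normSqGSO_eq]; exact hs.normSqGSO_le i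
  rw [step, dif_pos hrun']
  split
  · refine ⟨⟨Nat.le_add_left _ _, hmem, hC⟩, Prod.Lex.toLex_lt_toLex.2 (Or.inr ⟨?_, ?_⟩)⟩
    · simp only [hflag.normSqGSO_eq]
    · simp
  · rename_i i hi
    obtain ⟨hik, hlt⟩ := A.distSq_lt_of_test hδ (by exact hs.one_le_idx) hi
    refine ⟨⟨le_max_right _ _, fun j => ?_, ?_⟩, Prod.Lex.toLex_lt_toLex.2 (Or.inl ?_)⟩
    · obtain ⟨l, hl⟩ := moveTo_mem_range i ⟨s.idx, hrun'⟩ j (sizeReduce o s.basis)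
      simp only
      rw [← hl]
      exact hmem l
    · exact normSqGSO_moveTo_le hik.le hC (hlt.le.trans (hC i))
    -- As `i < k`, the drop occurs among the first `n - 1` positions, so the last norm may be
    -- ignored.
    · have hi1 : (i : ℕ) < n - 1 := by have := Fin.lt_def.1 hik; simp only at this; omega
      refine ⟨⟨i, hi1⟩, fun j hj => ?_, ?_⟩
      · have hj' : Fin.castLE (n.sub_le 1) j < i := Fin.lt_def.2 (Fin.lt_def.1 hj)
        change normSqGSO _ _ = normSqGSO _ _
        rw [normSqGSO_moveTo_of_lt _ hj', hflag.normSqGSO_eq]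
      · change normSqGSO _ i < normSqGSO _ i
        rw [normSqGSO_moveTo_self, ← hflag.normSqGSO_eq]
        exact hlt

lemma reachable_iterate {A : Algorithm} {o : ReductionOrder} {δ : ℝ} (hδ : A.Admissible δ)
    {b : Fin n → Vec n} {C : ℝ} {s : State n} (hs : Reachable b C s) {N : ℕ}
    (hrun : ∀ m < N, ((step A o δ)^[m] s).Running) :
    Reachable b C ((step A o δ)^[N] s) ∧
      ∀ m < N, progress ((step A o δ)^[N] s) < progress ((step A o δ)^[m] s) := by
  induction N with
  | zero => exact ⟨hs, fun m hm => absurd hm m.not_lt_zero⟩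
  | succ N ih =>
    obtain ⟨h1, h2⟩ := ih fun m hm => hrun m (hm.trans N.lt_succ_self)
    obtain ⟨h3, h4⟩ := reachable_step (o := o) hδ h1 (hrun N N.lt_succ_self)
    rw [Function.iterate_succ_apply']
    refine ⟨h3, fun m hm => ?_⟩
    rcases Nat.lt_succ_iff_lt_or_eq.1 hm with hm | rfl
    · exact h4.trans (h2 m hm)
    · exact h4

/-- While the loop runs, the pair formed by the boxes of the first `n - 1` vectors of the
size-reduced basis and the current index takes no value twice. -/
lemma card_le_of_running {A : Algorithm} {o : ReductionOrder} {δ : ℝ} (hδ : A.Admissible δ)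
    {b : Fin n → Vec n} (hb : LinearIndependent ℝ b) {M : ℝ} (hM0 : 0 ≤ M) {s : State n}
    (hs : Reachable b (M ^ 2) s) {N : ℕ} (hrun : ∀ m < N, ((step A o δ)^[m] s).Running) :
    N ≤ (∏ j : Fin (n - 1), (Fintype.piFinset fun i : Fin n =>
      Finset.range (⌊2 * (√((j : ℝ) + 4) / 2 * M) / ‖gso b i‖⌋₊ + 1)).card) * (n - 1) := by
  have hreach : ∀ m < N, Reachable b (M ^ 2) ((step A o δ)^[m] s) := fun m hm =>
    (reachable_iterate hδ hs fun l hl => hrun l (hl.trans hm)).1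
  have hex : ∀ m, ∃ c : Fin n → Vec n, m < N → SameFlag ((step A o δ)^[m] s).basis c ∧
      ∀ j : Fin n, ‖c j‖ ≤ √((j : ℝ) + 4) / 2 * M := by
    intro m
    by_cases hm : m < N
    · obtain ⟨c, hc, hcj⟩ := exists_sizeReduced _ (hreach m hm).normSqGSO_le
      refine ⟨c, fun _ => ⟨hc, fun j => ?_⟩⟩
      refine le_of_sq_le_sq ((hcj j).trans_eq ?_) (by positivity)
      rw [mul_pow, div_pow, Real.sq_sqrt (by positivity)]
      norm_num
    · exact ⟨0, fun h => absurd h hm⟩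
  choose c hc using hex
  have hcL : ∀ m < N, ∀ j, c m j ∈ Submodule.span ℤ (Set.range b) := fun m hm j =>
    Submodule.span_le.2 (Set.range_subset_iff.2 (hreach m hm).mem_span) ((hc m hm).1.mem_span j)
  let key : ℕ → (Fin (n - 1) → Fin n → ℕ) × ℕ := fun m =>
    (fun j => boxIndex b (√((j : ℝ) + 4) / 2 * M) (c m (Fin.castLE (n.sub_le 1) j)),
      ((step A o δ)^[m] s).idx)
  have hinj : ∀ m < N, ∀ l < m, key m ≠ key l := by
    intro m hm l hl heq
    have hlt := (reachable_iterate hδ hs fun p hp => hrun p (hp.trans hm)).2 l hl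
    refine hlt.ne ?_
    obtain ⟨h1, h2⟩ := Prod.ext_iff.1 heq
    have hlN := hl.trans hm
    have hcc : ∀ j : Fin (n - 1),
        c m (Fin.castLE (n.sub_le 1) j) = c l (Fin.castLE (n.sub_le 1) j) := fun j =>
      boxIndex_injective hb ((hc m hm).2 _) ((hc l hlN).2 _) (hcL m hm _) (hcL l hlN _)
        (congrFun h1 j)
    have hB : ∀ j : Fin (n - 1),
        normSqGSO ((step A o δ)^[m] s).basis (Fin.castLE (n.sub_le 1) j) =
          normSqGSO ((step A o δ)^[l] s).basis (Fin.castLE (n.sub_le 1) j) := by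
      intro j
      rw [← (hc m hm).1.normSqGSO_eq, ← (hc l hlN).1.normSqGSO_eq, normSqGSO, normSqGSO,
        gso_congr (b := c m) (c := c l)]
      intro i hi
      have hi' : (i : ℕ) ≤ j := Fin.le_def.1 hi
      exact hcc ⟨i, lt_of_le_of_lt hi' j.2⟩
    have h2' : ((step A o δ)^[m] s).idx = ((step A o δ)^[l] s).idx := h2
    rw [progress, progress, h2']
    simp only [hB]
  have hcard := Finset.card_le_card_of_injOn (s := Finset.range N)
    (t := (Fintype.piFinset fun j : Fin (n - 1) => Fintype.piFinset fun i : Fin n =>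
      Finset.range (⌊2 * (√((j : ℝ) + 4) / 2 * M) / ‖gso b i‖⌋₊ + 1)) ×ˢ Finset.Icc 1 (n - 1)) key
    (fun m hm => by
      have hm' : m < N := by simpa using hm
      have hrunm : ((step A o δ)^[m] s).idx < n := hrun m hm'
      rw [Finset.mem_coe, Finset.mem_product]
      refine ⟨Fintype.mem_piFinset.2 fun j => boxIndex_mem ((hc m hm').2 _), ?_⟩
      exact Finset.mem_Icc.2 ⟨(hreach m hm').one_le_idx, by simp only [key]; omega⟩)
    (fun m hm l hl heq => by
      rw [Finset.coe_range, Set.mem_Iio] at hm hl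
      rcases lt_trichotomy m l with h | h | h
      · exact absurd heq.symm (hinj l hl m h)
      · exact h
      · exact absurd heq (hinj m hm l h))
  simpa [Finset.card_product, Fintype.card_piFinset] using hcard

lemma norm_le_maxNorm (b : Fin n → Vec n) (i : Fin n) : ‖b i‖ ≤ maxNorm b :=
  le_ciSup (f := fun i => ‖b i‖) (Set.finite_range _).bddAbove i

lemma maxNorm_nonneg (b : Fin n → Vec n) : 0 ≤ maxNorm b :=
  Real.iSup_nonneg fun _ => norm_nonneg _

lemma norm_gso_le_maxNorm (b : Fin n → Vec n) (i : Fin n) : ‖gso b i‖ ≤ maxNorm b := by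
  rw [gso_eq]
  exact (Submodule.norm_starProjection_apply_le _ _).trans (norm_le_maxNorm b i)

lemma alpha_nonneg (b : Fin n → Vec n) : 0 ≤ alpha b :=
  div_nonneg (pow_nonneg (maxNorm_nonneg b) _) (Real.sqrt_nonneg _)

lemma prod_one_add_sqrt_le (m : ℕ) :
    ∏ j : Fin (m + 1), (√((j : ℝ) + 4) + 1) ≤
      3 * ∏ j ∈ Finset.Icc 2 (m + 1), (2 + √((j : ℝ) + 3)) := by
  have h4 : √(4 : ℝ) = 2 := by
    rw [show (4 : ℝ) = 2 ^ 2 by norm_num, Real.sqrt_sq (by norm_num)]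
  rw [Fin.prod_univ_eq_prod_range (fun j : ℕ => √((j : ℝ) + 4) + 1) (m + 1),
    Finset.prod_range_succ', ← Finset.Ico_add_one_right_eq_Icc, Finset.prod_Ico_eq_prod_range,
    mul_comm]
  -- The factor at `j = 0` is exactly `√4 + 1 = 3`; the others are weakened from `√ + 1` to `√ + 2`.
  simp only [Nat.cast_zero, zero_add, h4]
  norm_num
  refine Finset.prod_le_prod (fun _ _ => by positivity) fun j _ => ?_
  rw [show (j : ℝ) + 1 + 4 = 2 + j + 3 by ring]
  linarith

/-- All four algorithms halt, within the bound given by the number of boxes. -/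
theorem exists_haltsAfter {A : Algorithm} (o : ReductionOrder) {δ : ℝ} (hδ : A.Admissible δ)
    (hn : 2 ≤ n) {b : Fin n → Vec n} (hb : LinearIndependent ℝ b) :
    ∃ N : ℕ, HaltsAfter A o δ b N ∧
      (N : ℝ) ≤ ((n : ℝ) - 1) *
        (3 * ∏ j ∈ Finset.Icc 2 (n - 1), (2 + √((j : ℝ) + 3))) ^ n * alpha b ^ (n - 1) := by
  classical
  have hM0 := maxNorm_nonneg b
  have hs : Reachable b (maxNorm b ^ 2) (initial b) :=
    ⟨le_rfl, fun i => Submodule.subset_span ⟨i, rfl⟩, fun i =>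
      pow_le_pow_left₀ (norm_nonneg _) (norm_gso_le_maxNorm b i) 2⟩
  have hcard := fun N => card_le_of_running (A := A) (o := o) (N := N) hδ hb hM0 hs
  have hex : ∃ N, ¬ ((step A o δ)^[N] (initial b)).Running := by
    by_contra! hall
    exact absurd (hcard _ fun m _ => hall m) (Nat.not_succ_le_self _)
  refine ⟨Nat.find hex, ⟨fun m hm => not_not.1 (Nat.find_min hex hm), Nat.find_spec hex⟩, ?_⟩
  have hN := hcard (Nat.find hex) fun m hm => not_not.1 (Nat.find_min hex hm)
  have hN' : ((Nat.find hex : ℕ) : ℝ) ≤ _ := Nat.cast_le.2 hN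
  refine hN'.trans ?_
  rw [Nat.cast_mul, Nat.cast_prod, Nat.cast_sub (by omega), Nat.cast_one, mul_comm, mul_assoc]
  have hn1 : (0 : ℝ) ≤ (n : ℝ) - 1 := by
    have : (2 : ℝ) ≤ n := by exact_mod_cast hn
    linarith
  refine mul_le_mul_of_nonneg_left ?_ hn1
  calc _ ≤ ∏ j : Fin (n - 1), ((√((j : ℝ) + 4) + 1) ^ n * alpha b) := by
        refine Finset.prod_le_prod (fun _ _ => Nat.cast_nonneg _) fun j _ => ?_
        refine (card_boxes_le hb (by positivity) (norm_gso_le_maxNorm b)).trans_eq ?_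
        rw [alpha, mul_div_assoc', ← mul_pow]
        ring
    _ = (∏ j : Fin (n - 1), (√((j : ℝ) + 4) + 1)) ^ n * alpha b ^ (n - 1) := by
        rw [Finset.prod_mul_distrib, Finset.prod_pow]
        simp
    _ ≤ _ := by
        obtain ⟨m, hm⟩ : ∃ m, n - 1 = m + 1 := ⟨n - 2, by omega⟩
        have := prod_one_add_sqrt_le m
        rw [← hm] at this
        refine mul_le_mul_of_nonneg_right (pow_le_pow_left₀ ?_ this n) (pow_nonneg (alpha_nonneg b) _)
        exact Finset.prod_nonneg fun _ _ => by positivity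

end Halting

/-! ### Closed form and asymptotics of the bound -/

section Estimates

lemma prod_add_three_mul (m : ℕ) :
    (∏ j ∈ Finset.Icc 2 (m + 1), ((j : ℝ) + 3)) * 24 = ((m + 4).factorial : ℝ) := by
  induction m with
  | zero => norm_num [Nat.factorial]
  | succ m ih =>
    rw [Finset.prod_Icc_succ_top (by omega), mul_right_comm, ih,
      show m + 1 + 4 = (m + 4) + 1 by ring, Nat.factorial_succ (m + 4)]
    push_cast
    ring

/-- Since `j ≥ 2`, `2 ≤ (2 / √5) * √(j + 3)`. The remaining radicands multiply to `(m + 4)! / 24`,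
and `3 ^ 2 / 24 = 3 / 8`. -/
lemma three_mul_prod_le (m : ℕ) :
    3 * ∏ j ∈ Finset.Icc 2 (m + 1), (2 + √((j : ℝ) + 3)) ≤
      (2 / √5 + 1) ^ m * √(3 * ((m + 4).factorial : ℝ) / 8) := by
  have h1 : ∏ j ∈ Finset.Icc 2 (m + 1), (2 + √((j : ℝ) + 3)) ≤
      ∏ j ∈ Finset.Icc 2 (m + 1), ((2 / √5 + 1) * √((j : ℝ) + 3)) := by
    refine Finset.prod_le_prod (fun _ _ => by positivity) fun j hj => ?_
    have hj2 : (2 : ℝ) ≤ j := by exact_mod_cast (Finset.mem_Icc.1 hj).1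
    have hsq : √5 ≤ √((j : ℝ) + 3) := Real.sqrt_le_sqrt (by linarith)
    have h5 : 0 < √(5 : ℝ) := by positivity
    have : 2 ≤ 2 / √5 * √((j : ℝ) + 3) := by
      rw [div_mul_eq_mul_div, le_div_iff₀ h5]
      linarith
    linarith
  have h3 : 3 * √(∏ j ∈ Finset.Icc 2 (m + 1), ((j : ℝ) + 3)) =
      √(3 * ((m + 4).factorial : ℝ) / 8) := by
    rw [← prod_add_three_mul]
    rw [show 3 * ((∏ j ∈ Finset.Icc 2 (m + 1), ((j : ℝ) + 3)) * 24) / 8 =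
      3 ^ 2 * ∏ j ∈ Finset.Icc 2 (m + 1), ((j : ℝ) + 3) by ring, Real.sqrt_mul (by norm_num),
      Real.sqrt_sq (by norm_num)]
  have h2 : ∏ j ∈ Finset.Icc 2 (m + 1), √((j : ℝ) + 3) =
      √(∏ j ∈ Finset.Icc 2 (m + 1), ((j : ℝ) + 3)) :=
    (Real.sqrt_prod _ fun _ _ => by positivity).symm
  refine (mul_le_mul_of_nonneg_left h1 (by norm_num)).trans_eq ?_
  rw [Finset.prod_mul_distrib, Finset.prod_const, h2, ← h3, Nat.card_Icc]
  rw [show m + 1 + 1 - 2 = m by omega]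
  ring

lemma pow_three_mul_prod_le {n : ℕ} (hn : 2 ≤ n) :
    (3 * ∏ j ∈ Finset.Icc 2 (n - 1), (2 + √((j : ℝ) + 3))) ^ n ≤
      (2 / √5 + 1) ^ (n * (n - 2)) * (3 * ((n + 2).factorial : ℝ) / 8) ^ ((n : ℝ) / 2) := by
  obtain ⟨m, rfl⟩ : ∃ m, n = m + 2 := ⟨n - 2, by omega⟩
  have h := three_mul_prod_le m
  have h0 : 0 ≤ 3 * ∏ j ∈ Finset.Icc 2 (m + 1), (2 + √((j : ℝ) + 3)) :=
    mul_nonneg (by norm_num) (Finset.prod_nonneg fun _ _ => by positivity)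
  refine (pow_le_pow_left₀ h0 h (m + 2)).trans_eq ?_
  rw [mul_pow, ← pow_mul, mul_comm m, Real.sqrt_eq_rpow (3 * _ / 8), ← Real.rpow_natCast (_ ^ (1 / 2 : ℝ)),
    ← Real.rpow_mul (by positivity)]
  simp only [Nat.add_sub_cancel]
  congr 2
  ring

/-- The logarithm of the simplified bound, without the power of `α`. -/
def logBound (n : ℕ) : ℝ :=
  Real.log ((n : ℝ) - 1) + (n * ((n : ℝ) - 2)) * Real.log (2 / √5 + 1) +
    (n : ℝ) / 2 * Real.log (3 * ((n + 2).factorial : ℝ) / 8)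

lemma exp_logBound {n : ℕ} (hn : 2 ≤ n) : Real.exp (logBound n) =
    ((n : ℝ) - 1) * (2 / √5 + 1) ^ (n * (n - 2)) *
      (3 * ((n + 2).factorial : ℝ) / 8) ^ ((n : ℝ) / 2) := by
  have hn' : (2 : ℝ) ≤ n := by exact_mod_cast hn
  rw [logBound, Real.exp_add, Real.exp_add, Real.exp_log (by linarith),
    Real.rpow_def_of_pos (by positivity), mul_comm ((n : ℝ) / 2)]
  congr 2
  rw [← Real.rpow_natCast, Real.rpow_def_of_pos (by positivity), mul_comm]
  push_cast [Nat.cast_sub hn]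
  rfl

/-- The correction `ε_n` of the exponent of `n`. -/
def exponentError (n : ℕ) : ℝ :=
  (logBound n / (n : ℝ) ^ 2 - Real.log (2 / √5 + 1) + 1 / 2) / Real.log n - 1 / 2

/-- `exponentError` is obtained by solving this equation for the exponent, so only its convergence
needs proof. -/
lemma pow_exponentError {n : ℕ} (hn : 2 ≤ n) :
    ((2 / √5 + 1) * Real.exp (-1 / 2) * (n : ℝ) ^ (1 / 2 + exponentError n)) ^ (n ^ 2) =
      Real.exp (logBound n) := by
  have hn' : (2 : ℝ) ≤ n := by exact_mod_cast hn
  have hlog : 0 < Real.log n := Real.log_pos (by linarith)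
  have hc : (0 : ℝ) < 2 / √5 + 1 := by positivity
  rw [Real.rpow_def_of_pos (by linarith), ← Real.exp_log hc, ← Real.exp_add, ← Real.exp_add,
    ← Real.exp_nat_mul, exponentError]
  congr 1
  push_cast
  field_simp
  ring

lemma tendsto_log_factorial_div :
    Tendsto (fun n : ℕ => Real.log (n.factorial : ℝ) / (n * Real.log n)) atTop (𝓝 1) := by
  have hlog : Tendsto (fun n : ℕ => Real.log (n : ℝ)) atTop atTop :=
    Real.tendsto_log_atTop.comp tendsto_natCast_atTop_atTop
  have hlow : Tendsto (fun n : ℕ => 1 - (Real.log (n : ℝ))⁻¹) atTop (𝓝 1) := by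
    simpa using (tendsto_const_nhds (x := (1 : ℝ))).sub hlog.inv_tendsto_atTop
  refine tendsto_of_tendsto_of_tendsto_of_le_of_le' hlow tendsto_const_nhds ?_ ?_ <;>
    filter_upwards [eventually_ge_atTop 2] with n hn
  all_goals
    have hn' : (2 : ℝ) ≤ n := by exact_mod_cast hn
    have hl : 0 < Real.log n := Real.log_pos (by linarith)
  · have h := Stirling.le_log_factorial_stirling (n := n) (by omega)
    have hpi : 0 ≤ Real.log (2 * Real.pi) :=
      Real.log_nonneg (by linarith [Real.pi_gt_three])
    rw [le_div_iff₀ (by positivity), sub_mul, one_mul, mul_comm (n : ℝ), inv_mul_cancel_left₀ hl.ne']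
    linarith
  · rw [div_le_one (by positivity), ← Real.log_pow]
    exact Real.log_le_log (by positivity) (by exact_mod_cast n.factorial_le_pow)

lemma tendsto_exponentError : Tendsto exponentError atTop (𝓝 0) := by
  have hcast : Tendsto (fun n : ℕ => (n : ℝ)) atTop atTop := tendsto_natCast_atTop_atTop
  have hlog : Tendsto (fun n : ℕ => Real.log (n : ℝ)) atTop atTop :=
    Real.tendsto_log_atTop.comp hcast
  have hinv := hcast.inv_tendsto_atTop
  have hloginv := hlog.inv_tendsto_atTop
  have hdiv : ∀ c : ℝ, Tendsto (fun n : ℕ => Real.log ((n : ℝ) + c) / Real.log n) atTop (𝓝 1) := by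
    intro c
    have h1 : Tendsto (fun n : ℕ => Real.log ((n : ℝ) + c) - Real.log n) atTop (𝓝 0) :=
      (Real.tendsto_log_comp_add_sub_log c).comp hcast
    have h2 := (h1.mul hloginv).add_const 1
    rw [zero_mul, zero_add] at h2
    refine h2.congr' ?_
    filter_upwards [eventually_ge_atTop 2] with n hn
    have hn' : (2 : ℝ) ≤ n := by exact_mod_cast hn
    have hl : 0 < Real.log n := Real.log_pos (by linarith)
    simp only [Pi.inv_apply]
    field_simp
    ring
  set L := Real.log (2 / √5 + 1)
  -- Only `log n! / (n log n) → 1` survives; its coefficient `1 / 2` cancels the final `- 1 / 2`.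
  have main : Tendsto (fun n : ℕ =>
      Real.log ((n : ℝ) + (-1)) / Real.log n * (n : ℝ)⁻¹ * (n : ℝ)⁻¹ +
      (-2 * L * (n : ℝ)⁻¹ + 1 / 2) * (Real.log n)⁻¹ +
      1 / 2 * (Real.log (3 / 8) * ((n : ℝ)⁻¹ * (Real.log n)⁻¹) +
        Real.log ((n : ℝ) + 2) / Real.log n * (n : ℝ)⁻¹ +
        Real.log ((n : ℝ) + 1) / Real.log n * (n : ℝ)⁻¹ +
        Real.log (n.factorial : ℝ) / (n * Real.log n)) - 1 / 2) atTop
      (𝓝 (1 * 0 * 0 + (-2 * L * 0 + 1 / 2) * 0 +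
        1 / 2 * (Real.log (3 / 8) * (0 * 0) + 1 * 0 + 1 * 0 + 1) - 1 / 2)) :=
    (((((hdiv (-1)).mul hinv).mul hinv).add (((hinv.const_mul _).add_const _).mul hloginv)).add
      ((((((hinv.mul hloginv).const_mul _).add ((hdiv 2).mul hinv)).add
        ((hdiv 1).mul hinv)).add tendsto_log_factorial_div).const_mul _)).sub_const _
  have hzero : (1 * 0 * 0 + (-2 * L * 0 + 1 / 2) * 0 +
        1 / 2 * (Real.log (3 / 8) * (0 * 0) + 1 * 0 + 1 * 0 + 1) - 1 / 2 : ℝ) = 0 := by ring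
  rw [hzero] at main
  refine main.congr' ?_
  filter_upwards [eventually_ge_atTop 2] with n hn
  have hn' : (2 : ℝ) ≤ n := by exact_mod_cast hn
  have hl : 0 < Real.log n := Real.log_pos (by linarith)
  have hfac : Real.log (3 * ((n + 2).factorial : ℝ) / 8) =
      Real.log (3 / 8) + Real.log ((n : ℝ) + 2) + Real.log ((n : ℝ) + 1) +
        Real.log (n.factorial : ℝ) := by
    rw [← Real.log_mul (by norm_num) (by positivity), ← Real.log_mul (by positivity) (by positivity),
      ← Real.log_mul (by positivity) (by positivity), Nat.factorial_succ (n + 1),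
      Nat.factorial_succ n]
    push_cast
    congr 1
    ring
  rw [exponentError, logBound, hfac, ← sub_eq_add_neg, show Real.log (2 / √5 + 1) = L from rfl]
  clear_value L
  field_simp
  ring

end Estimates

end LatticeReduction

end

theorem mainTheorem1 :
    ∃ ε : ℕ → ℝ, Tendsto ε atTop (𝓝 0) ∧
      ∀ n : ℕ, 2 ≤ n →
        ∀ b : Fin n → EuclideanSpace ℝ (Fin n), LinearIndependent ℝ b →
          (∀ (A : LatticeReduction.Algorithm) (o : LatticeReduction.ReductionOrder) (δ : ℝ),
            A.Admissible δ →
              ∃ N : ℕ, LatticeReduction.HaltsAfter A o δ b N ∧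
                (N : ℝ) ≤ ((n : ℝ) - 1) *
                  (3 * ∏ j ∈ Finset.Icc 2 (n - 1), (2 + √((j : ℝ) + 3))) ^ n *
                    LatticeReduction.alpha b ^ (n - 1)) ∧
          ((n : ℝ) - 1) * (3 * ∏ j ∈ Finset.Icc 2 (n - 1), (2 + √((j : ℝ) + 3))) ^ n *
              LatticeReduction.alpha b ^ (n - 1) ≤
            ((n : ℝ) - 1) * (2 / √5 + 1) ^ (n * (n - 2)) * LatticeReduction.alpha b ^ (n - 1) *
              (3 * ((n + 2).factorial : ℝ) / 8) ^ ((n : ℝ) / 2) ∧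
          ((n : ℝ) - 1) * (2 / √5 + 1) ^ (n * (n - 2)) * LatticeReduction.alpha b ^ (n - 1) *
              (3 * ((n + 2).factorial : ℝ) / 8) ^ ((n : ℝ) / 2) =
            LatticeReduction.alpha b ^ (n - 1) *
              ((2 / √5 + 1) * Real.exp (-1 / 2) * (n : ℝ) ^ (1 / 2 + ε n)) ^ (n ^ 2) := by
  refine ⟨LatticeReduction.exponentError, LatticeReduction.tendsto_exponentError,
    fun n hn b hb => ⟨fun A o δ hδ => LatticeReduction.exists_haltsAfter o hδ hn hb, ?_, ?_⟩⟩
  · have hn1 : (0 : ℝ) ≤ (n : ℝ) - 1 := by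
      have : (2 : ℝ) ≤ n := by exact_mod_cast hn
      linarith
    have h := mul_le_mul_of_nonneg_right (mul_le_mul_of_nonneg_left
      (LatticeReduction.pow_three_mul_prod_le hn) hn1)
      (pow_nonneg (LatticeReduction.alpha_nonneg b) (n - 1))
    refine h.trans_eq ?_
    ring
  · rw [LatticeReduction.pow_exponentError hn, LatticeReduction.exp_logBound hn]
    ring
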